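/- Let $d\ge 2$ be an integer and let $\mu,\lambda,A,\gamma\in\mathbb R$ satisfy $\mu>0$, $\lambda+2\mu>0$, $A>0$ and $\gamma>1$. Let $\rho:\mathbb R^d\to[0,\infty)$ and $v:\mathbb R^d\to\mathbb R^d$ be $C^\infty$ functions that satisfy, on all of $\mathbb R^d$, the stationary barotropic compressible Navier--Stokes equations $$\nabla\cdot(\rho v)=0,\qquad \nabla\cdot(\rho v\otimes v)=-\nabla P+\mu\Delta v+(\mu+\lambda)\nabla(\nabla\cdot v),\qquad P=A\rho^\gamma .$$ If $$\|\rho\|_{L^\infty(\mathbb R^d)}+\|v\|_{L^{d/(d-1)}(\mathbb R^d)}+\|v\|_{L^{3d/(d-1)}(\mathbb R^d)}<\infty,$$ then $v\equiv 0$ and $\rho$ is constant on $\mathbb R^d$. -/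

import Mathlib

open MeasureTheory

open scoped Gradient Laplacian ContDiff

namespace CompressibleNS

/-- The divergence `∑ i, ∂ᵢ wᵢ` of a vector field on `ℝᵈ`. -/
noncomputable def divergence {d : ℕ}
    (w : EuclideanSpace ℝ (Fin d) → EuclideanSpace ℝ (Fin d))
    (x : EuclideanSpace ℝ (Fin d)) : ℝ :=
  ∑ i, fderiv ℝ (fun y => w y i) x (EuclideanSpace.single i 1)

/-- The barotropic pressure `P = A ρ ^ γ`. -/
noncomputable def pressure {d : ℕ} (A γ : ℝ) (ρ : EuclideanSpace ℝ (Fin d) → ℝ)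
    (x : EuclideanSpace ℝ (Fin d)) : ℝ :=
  A * ρ x ^ γ

/-- `(ρ, v)` is a smooth (`C^∞`) stationary solution on `ℝᵈ` of the barotropic compressible
Navier-Stokes equations with viscosities `μ`, `lam` and pressure law `P = A ρ ^ γ`.
The density is nonnegative; vacuum is allowed. -/
structure IsSmoothStationarySolution {d : ℕ} (μ lam A γ : ℝ)
    (ρ : EuclideanSpace ℝ (Fin d) → ℝ)
    (v : EuclideanSpace ℝ (Fin d) → EuclideanSpace ℝ (Fin d)) : Prop where
  smooth_density : ContDiff ℝ ∞ ρ
  smooth_velocity : ContDiff ℝ ∞ v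
  density_nonneg : ∀ x, 0 ≤ ρ x
  /-- Conservation of mass, `∇ · (ρ v) = 0`. -/
  mass : ∀ x, divergence (fun y => ρ y • v y) x = 0
  /-- The `i`-th component of
  `∇ · (ρ v ⊗ v) = - ∇ P + μ Δ v + (μ + lam) ∇ (∇ · v)`. -/
  momentum : ∀ x i,
    divergence (fun y => (ρ y * v y i) • v y) x =
      - (∇ (pressure A γ ρ) x) i + μ * (Δ v x) i + (μ + lam) * (∇ (divergence v) x) i

end CompressibleNS

namespace CompressibleNS

open Finset

/-! Test the momentum equation with `v`. Since `∇ · (ρ v) = 0`, transport and pressure contribute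
only the divergences of `ρ v |v|² / 2` and `A γ / (γ - 1) ρ^γ v`; the viscous terms contribute the
dissipation and further divergences. As only `lam + 2 μ > 0` is known, `μ + lam` may be negative. A
multiple of the null form `∑ ∂ᵢvⱼ ∂ⱼvᵢ - (∇ · v)²`, itself the divergence of `(v · ∇) v - (∇ · v)
v`, repairs coercivity: `c |∇v|² ≤ -∇ · K` with `c = min μ (lam + 2 μ)` (`energy_le`).

Bounded density gives `|K| ≲ |v| + |v|³ + |v| |∇v|`. A Caccioppoli argument with the cutoff `η²`
absorbs the gradient term and leaves `∫ η² |∇v|² ≲ R⁻¹ ∫ (|v| + |v|³)` over `R ≤ |x| ≤ 2R`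
(`eq_zero_of_le_neg_divergence`). The integrand lies in `L^{d/(d-1)}`, precisely the exponent for
which Hölder on the annulus costs one factor `R`, so the right side is controlled by a vanishing
tail (`tendsto_annulus_average`).

Hence `∇v = 0`; a constant in `L^{d/(d-1)}` is zero, and the momentum equation reduces to `∇ρ^γ =
0`. -/

/-- Euclidean space `ℝᵈ`. -/
abbrev Euc (d : ℕ) : Type := EuclideanSpace ℝ (Fin d)

/-- The partial derivative `∂ᵢ f`. -/
noncomputable def partialDeriv {d : ℕ} (i : Fin d) (f : Euc d → ℝ) (x : Euc d) : ℝ :=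
  fderiv ℝ f x (EuclideanSpace.single i 1)

/-! ### Calculus of partial derivatives in coordinates. -/

section PartialDeriv

lemma two_le_infty : (2 : WithTop ℕ∞) ≤ ∞ :=
  WithTop.coe_le_coe.2 (le_top : (2 : ℕ∞) ≤ ⊤)

variable {d : ℕ} {f g : Euc d → ℝ} {x : Euc d} (i : Fin d)

lemma partialDeriv_const (c : ℝ) : partialDeriv i (fun _ : Euc d => c) = fun _ => 0 := by
  ext x
  simp [partialDeriv]

lemma partialDeriv_add (hf : DifferentiableAt ℝ f x) (hg : DifferentiableAt ℝ g x) :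
    partialDeriv i (fun y => f y + g y) x = partialDeriv i f x + partialDeriv i g x := by
  simp only [partialDeriv]
  rw [fderiv_fun_add hf hg]
  simp

lemma partialDeriv_sub (hf : DifferentiableAt ℝ f x) (hg : DifferentiableAt ℝ g x) :
    partialDeriv i (fun y => f y - g y) x = partialDeriv i f x - partialDeriv i g x := by
  simp only [partialDeriv]
  rw [fderiv_fun_sub hf hg]
  simp

lemma partialDeriv_mul (hf : DifferentiableAt ℝ f x) (hg : DifferentiableAt ℝ g x) :
    partialDeriv i (fun y => f y * g y) x
      = f x * partialDeriv i g x + g x * partialDeriv i f x := by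
  simp only [partialDeriv]
  rw [fderiv_fun_mul hf hg]
  simp

lemma partialDeriv_const_mul (c : ℝ) (hf : DifferentiableAt ℝ f x) :
    partialDeriv i (fun y => c * f y) x = c * partialDeriv i f x := by
  simp only [partialDeriv]
  rw [fderiv_const_mul hf]
  simp

lemma partialDeriv_sum {ι : Type*} (s : Finset ι) {F : ι → Euc d → ℝ}
    (hF : ∀ j ∈ s, DifferentiableAt ℝ (F j) x) :
    partialDeriv i (fun y => ∑ j ∈ s, F j y) x = ∑ j ∈ s, partialDeriv i (F j) x := by
  simp only [partialDeriv]
  rw [fderiv_fun_sum hF]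
  simp

lemma partialDeriv_rpow {γ : ℝ} (hγ : 1 ≤ γ) (hf : DifferentiableAt ℝ f x) :
    partialDeriv i (fun y => f y ^ γ) x = γ * f x ^ (γ - 1) * partialDeriv i f x := by
  simp only [partialDeriv]
  rw [(hf.hasFDerivAt.rpow_const (Or.inr hγ)).fderiv]
  simp

lemma contDiff_partialDeriv (hf : ContDiff ℝ ∞ f) : ContDiff ℝ ∞ (partialDeriv i f) :=
  (hf.fderiv_right (m := ∞) (by simp)).clm_apply contDiff_const

lemma continuous_partialDeriv (hf : ContDiff ℝ 1 f) : Continuous (partialDeriv i f) :=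
  (hf.continuous_fderiv (by simp)).clm_apply continuous_const

lemma partialDeriv_comm (hf : ContDiff ℝ ∞ f) (j : Fin d) (x : Euc d) :
    partialDeriv i (partialDeriv j f) x = partialDeriv j (partialDeriv i f) x := by
  have key : ∀ k l : Fin d, partialDeriv k (partialDeriv l f) x
      = fderiv ℝ (fderiv ℝ f) x (EuclideanSpace.single k 1) (EuclideanSpace.single l 1) := by
    intro k l
    have hd : DifferentiableAt ℝ (fderiv ℝ f) x :=
      ((hf.fderiv_right (m := ∞) (by simp)).differentiable (by simp)) x
    have := (hd.hasFDerivAt.clm_apply (hasFDerivAt_const (EuclideanSpace.single l (1 : ℝ)) x)).fderiv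
    unfold partialDeriv
    rw [this]
    simp
  rw [key, key]
  exact (hf.contDiffAt.isSymmSndFDerivAt (by simpa using two_le_infty)) _ _

lemma gradient_apply (f : Euc d → ℝ) (x : Euc d) (i : Fin d) :
    (∇ f x) i = partialDeriv i f x := by
  rw [partialDeriv, ← inner_gradient_left, EuclideanSpace.inner_single_right]
  simp

lemma laplacian_apply {v : Euc d → Euc d} (hv : ContDiff ℝ ∞ v) (x : Euc d) (i : Fin d) :
    (Δ v x) i = ∑ j, partialDeriv j (partialDeriv j fun y => v y i) x := by
  have h := (hv.of_le (m := 2) two_le_infty).contDiffAt.laplacian_CLM_comp_left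
    (x := x) (l := (EuclideanSpace.proj i : Euc d →L[ℝ] ℝ))
  have hvi : ContDiff ℝ ∞ (fun y => v y i) :=
    (EuclideanSpace.proj i : Euc d →L[ℝ] ℝ).contDiff.comp hv
  calc (Δ v x) i = Δ (fun y => v y i) x := h.symm
    _ = _ := by
      rw [InnerProductSpace.laplacian_eq_iteratedFDeriv_orthonormalBasis _
        (EuclideanSpace.basisFun (Fin d) ℝ)]
      refine sum_congr rfl fun j _ => ?_
      rw [iteratedFDeriv_two_apply]
      have hd : DifferentiableAt ℝ (fderiv ℝ (fun y => v y i)) x :=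
        ((hvi.fderiv_right (m := ∞) (by simp)).differentiable (by simp)) x
      have := (hd.hasFDerivAt.clm_apply
        (hasFDerivAt_const (EuclideanSpace.single j (1 : ℝ)) x)).fderiv
      unfold partialDeriv
      rw [this]
      simp

end PartialDeriv

/-! ### Divergence identities for the terms of the energy balance. -/

section Identities

variable {d : ℕ} {ρ : Euc d → ℝ} {u : Fin d → Euc d → ℝ}

/-- The transport term is a divergence when `∇ · (ρ u) = 0`. -/
lemma sum_partialDeriv_kineticFlux (hρ : ContDiff ℝ ∞ ρ) (hu : ∀ i, ContDiff ℝ ∞ (u i))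
    (x : Euc d) (hmass : ∑ i, partialDeriv i (fun y => ρ y * u i y) x = 0) :
    ∑ i, partialDeriv i (fun y => (ρ y * u i y) * ∑ j, u j y * u j y) x
      = 2 * ∑ j, u j x * ∑ i, partialDeriv i (fun y => ρ y * u j y * u i y) x := by
  have dρ : DifferentiableAt ℝ ρ x := hρ.differentiable (by simp) x
  have du : ∀ i, DifferentiableAt ℝ (u i) x := fun i => (hu i).differentiable (by simp) x
  have h1 : ∀ i, partialDeriv i (fun y => (ρ y * u i y) * ∑ j, u j y * u j y) x
      = (∑ j, 2 * u j x * (ρ x * u i x * partialDeriv i (u j) x))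
        + (∑ j, u j x * u j x) * partialDeriv i (fun y => ρ y * u i y) x := by
    intro i
    rw [partialDeriv_mul i (dρ.fun_mul (du i)) (DifferentiableAt.fun_sum fun j _ => (du j).fun_mul (du j)),
      partialDeriv_sum i _ (fun j _ => (du j).fun_mul (du j)), mul_sum]
    congr 1
    refine sum_congr rfl fun j _ => ?_
    rw [partialDeriv_mul i (du j) (du j)]
    ring
  have h2 : ∀ i j, partialDeriv i (fun y => ρ y * u j y * u i y) x
      = ρ x * u i x * partialDeriv i (u j) x
        + u j x * partialDeriv i (fun y => ρ y * u i y) x := by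
    intro i j
    rw [show (fun y => ρ y * u j y * u i y) = fun y => u j y * (ρ y * u i y) by ext; ring,
      partialDeriv_mul i (du j) (dρ.fun_mul (du i))]
    ring
  simp only [h1, h2, sum_add_distrib, ← mul_sum, hmass, mul_zero, add_zero]
  rw [sum_comm]
  simp only [mul_sum]
  refine sum_congr rfl fun j _ => sum_congr rfl fun i _ => by ring

/-- The work of the pressure is a divergence when `∇ · (ρ u) = 0`. -/
lemma sum_partialDeriv_rpow_mul {γ : ℝ} (hγ : 1 < γ) (hρ : ContDiff ℝ ∞ ρ)
    (hu : ∀ i, ContDiff ℝ ∞ (u i)) (x : Euc d) (hx : 0 ≤ ρ x)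
    (hmass : ∑ i, partialDeriv i (fun y => ρ y * u i y) x = 0) :
    γ * ∑ i, partialDeriv i (fun y => ρ y ^ γ * u i y) x
      = (γ - 1) * ∑ i, u i x * partialDeriv i (fun y => ρ y ^ γ) x := by
  have dρ : DifferentiableAt ℝ ρ x := hρ.differentiable (by simp) x
  have du : ∀ i, DifferentiableAt ℝ (u i) x := fun i => (hu i).differentiable (by simp) x
  -- This also holds at vacuum points: for `ρ x = 0` both sides vanish because `γ ≠ 0`.
  have hpow : ρ x ^ γ = ρ x ^ (γ - 1) * ρ x := by
    rw [← Real.rpow_add_one' hx (by linarith)]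
    simp
  have h1 : ∀ i, partialDeriv i (fun y => ρ y ^ γ * u i y) x
      = ρ x ^ (γ - 1) * partialDeriv i (fun y => ρ y * u i y) x
        + (γ - 1) * ρ x ^ (γ - 1) * (u i x * partialDeriv i ρ x) := by
    intro i
    rw [partialDeriv_mul i (dρ.rpow_const (Or.inr hγ.le)) (du i), partialDeriv_mul i dρ (du i),
      partialDeriv_rpow i hγ.le dρ, hpow]
    ring
  simp only [h1, sum_add_distrib, ← mul_sum, hmass, partialDeriv_rpow _ hγ.le dρ]
  simp only [mul_sum, mul_zero, zero_add]
  refine sum_congr rfl fun i _ => by ring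

/-- Turns `u · Δu` into a divergence minus the dissipation `|∇u|²`. -/
lemma sum_partialDeriv_gradFlux (hu : ∀ i, ContDiff ℝ ∞ (u i)) (x : Euc d) :
    ∑ i, partialDeriv i (fun y => ∑ j, u j y * partialDeriv i (u j) y) x
      = ∑ j, u j x * ∑ i, partialDeriv i (partialDeriv i (u j)) x
        + ∑ i, ∑ j, partialDeriv i (u j) x ^ 2 := by
  have du : ∀ i, DifferentiableAt ℝ (u i) x := fun i => (hu i).differentiable (by simp) x
  have ddu : ∀ i j, DifferentiableAt ℝ (partialDeriv i (u j)) x :=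
    fun i j => (contDiff_partialDeriv i (hu j)).differentiable (by simp) x
  have h1 : ∀ i, partialDeriv i (fun y => ∑ j, u j y * partialDeriv i (u j) y) x
      = ∑ j, (u j x * partialDeriv i (partialDeriv i (u j)) x + partialDeriv i (u j) x ^ 2) := by
    intro i
    rw [partialDeriv_sum i _ fun j _ => (du j).fun_mul (ddu i j)]
    refine sum_congr rfl fun j _ => ?_
    rw [partialDeriv_mul i (du j) (ddu i j)]
    ring
  simp only [h1, sum_add_distrib, mul_sum]
  rw [sum_comm]

/-- The counterpart for `u · ∇(∇ · u)`, whose dissipation is `(∇ · u)²`. -/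
lemma sum_partialDeriv_divFlux (hu : ∀ i, ContDiff ℝ ∞ (u i)) (x : Euc d) :
    ∑ i, partialDeriv i (fun y => u i y * ∑ j, partialDeriv j (u j) y) x
      = ∑ i, u i x * partialDeriv i (fun y => ∑ j, partialDeriv j (u j) y) x
        + (∑ j, partialDeriv j (u j) x) ^ 2 := by
  have du : ∀ i, DifferentiableAt ℝ (u i) x := fun i => (hu i).differentiable (by simp) x
  have ddu : ∀ i j, DifferentiableAt ℝ (partialDeriv i (u j)) x :=
    fun i j => (contDiff_partialDeriv i (hu j)).differentiable (by simp) x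
  have h1 : ∀ i, partialDeriv i (fun y => u i y * ∑ j, partialDeriv j (u j) y) x
      = u i x * partialDeriv i (fun y => ∑ j, partialDeriv j (u j) y) x
        + (∑ j, partialDeriv j (u j) x) * partialDeriv i (u i) x :=
    fun i => partialDeriv_mul i (du i) (DifferentiableAt.fun_sum fun j _ => ddu j j)
  simp only [h1, sum_add_distrib, ← mul_sum]
  ring

/-- Symmetry of second derivatives makes the second-order part the same as for `u (∇ · u)`.
Subtracting the two identities therefore exhibits the null form `∑ ∂ᵢuⱼ ∂ⱼuᵢ - (∇ · u)²` as a
divergence. -/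
lemma sum_partialDeriv_advectFlux (hu : ∀ i, ContDiff ℝ ∞ (u i)) (x : Euc d) :
    ∑ i, partialDeriv i (fun y => ∑ j, u j y * partialDeriv j (u i) y) x
      = ∑ i, u i x * partialDeriv i (fun y => ∑ j, partialDeriv j (u j) y) x
        + ∑ i, ∑ j, partialDeriv i (u j) x * partialDeriv j (u i) x := by
  have du : ∀ i, DifferentiableAt ℝ (u i) x := fun i => (hu i).differentiable (by simp) x
  have ddu : ∀ i j, DifferentiableAt ℝ (partialDeriv i (u j)) x :=
    fun i j => (contDiff_partialDeriv i (hu j)).differentiable (by simp) x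
  have h1 : ∀ i, partialDeriv i (fun y => ∑ j, u j y * partialDeriv j (u i) y) x
      = ∑ j, (u j x * partialDeriv j (partialDeriv i (u i)) x
        + partialDeriv i (u j) x * partialDeriv j (u i) x) := by
    intro i
    rw [partialDeriv_sum i _ fun j _ => (du j).fun_mul (ddu j i)]
    refine sum_congr rfl fun j _ => ?_
    rw [partialDeriv_mul i (du j) (ddu j i), partialDeriv_comm i (hu i)]
    ring
  simp only [h1, sum_add_distrib]
  rw [sum_comm]
  congr 1
  refine sum_congr rfl fun i _ => ?_
  rw [partialDeriv_sum i _ fun j _ => ddu j j, mul_sum]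

/-- Pointwise comparison behind the coercivity of the viscous terms. -/
lemma sum_mul_swap_le_sum_sq (a : Fin d → Fin d → ℝ) :
    ∑ i, ∑ j, a i j * a j i ≤ ∑ i, ∑ j, a i j ^ 2 := by
  have h : ∑ i, ∑ j, a j i ^ 2 = ∑ i, ∑ j, a i j ^ 2 := sum_comm
  have h2 : ∑ i, ∑ j, 2 * (a i j * a j i) ≤ ∑ i, ∑ j, (a i j ^ 2 + a j i ^ 2) :=
    sum_le_sum fun i _ => sum_le_sum fun j _ => by nlinarith [sq_nonneg (a i j - a j i)]
  simp only [sum_add_distrib, h, ← mul_sum] at h2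
  linarith

end Identities

/-! ### Cutoffs, annular averages and the Liouville principle. -/

open Finset Filter Topology Metric

section Integration

variable {d : ℕ}

/-- The dyadic annulus `R ≤ |x| ≤ 2 R`. -/
def annulus (d : ℕ) (R : ℝ) : Set (Euc d) := closedBall 0 (2 * R) \ ball 0 R

lemma measurableSet_annulus (R : ℝ) : MeasurableSet (annulus d R) :=
  measurableSet_closedBall.diff measurableSet_ball

lemma isCompact_annulus (R : ℝ) : IsCompact (annulus d R) :=
  (isCompact_closedBall _ _).diff isOpen_ball

lemma hasCompactSupport_sq {f : Euc d → ℝ} (hf : HasCompactSupport f) :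
    HasCompactSupport fun x => f x ^ 2 :=
  hf.comp_left (g := fun t : ℝ => t ^ 2) (by simp)

lemma hasCompactSupport_partialDeriv (i : Fin d) {f : Euc d → ℝ} (hf : HasCompactSupport f) :
    HasCompactSupport (partialDeriv i f) :=
  (hf.fderiv ℝ).comp_left (g := fun L : Euc d →L[ℝ] ℝ => L (EuclideanSpace.single i 1)) (by simp)

/-- Regularity `C¹` is what is available later: with vacuum allowed, `ρ ^ γ` need not be smoother
when `γ` is close to `1`. -/
lemma integral_mul_partialDeriv (i : Fin d) {φ f : Euc d → ℝ} (hφ : ContDiff ℝ 1 φ)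
    (hc : HasCompactSupport φ) (hf : ContDiff ℝ 1 f) :
    ∫ x, φ x * partialDeriv i f x = -∫ x, partialDeriv i φ x * f x := by
  have hcφ := hasCompactSupport_partialDeriv i hc
  refine integral_mul_fderiv_eq_neg_fderiv_mul_of_integrable ?_ ?_ ?_
    (fun x _ => hφ.differentiable (by simp) x) (fun x _ => hf.differentiable (by simp) x)
  · exact ((continuous_partialDeriv i hφ).mul hf.continuous).integrable_of_hasCompactSupport
      hcφ.mul_right
  · exact (hφ.continuous.mul (continuous_partialDeriv i hf)).integrable_of_hasCompactSupport
      hc.mul_right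
  · exact (hφ.continuous.mul hf.continuous).integrable_of_hasCompactSupport hc.mul_right

/-- Smooth cutoffs equal to `1` on `B_R`, supported in `B_{2R}`, with gradient `O(1 / R)`. -/
lemma exists_cutoff (d : ℕ) : ∃ C : ℝ, 0 ≤ C ∧ ∀ R : ℝ, 0 < R → ∃ η : Euc d → ℝ,
    ContDiff ℝ ∞ η ∧ HasCompactSupport η ∧ (∀ x, 0 ≤ η x) ∧ (∀ x, η x ≤ 1) ∧
    (∀ x, ‖x‖ ≤ R → η x = 1) ∧ (∀ x, 2 * R ≤ ‖x‖ → η x = 0) ∧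
    (∀ i x, |partialDeriv i η x| ≤ C / R) ∧
    (∀ i x, x ∉ annulus d R → partialDeriv i η x = 0) := by
  -- One fixed bump, rescaled by `R`, makes the gradient constant independent of `R`.
  let b : ContDiffBump (0 : Euc d) := ⟨1, 2, by norm_num, by norm_num⟩
  have hb : ContDiff ℝ ∞ b := b.contDiff
  obtain ⟨C, hC⟩ := (hb.continuous_fderiv (by simp)).bounded_above_of_compact_support
    (b.hasCompactSupport.fderiv ℝ)
  refine ⟨C, (norm_nonneg _).trans (hC 0), fun R hR => ?_⟩
  have hnorm : ∀ x : Euc d, ‖R⁻¹ • x‖ = ‖x‖ / R := fun x => by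
    rw [norm_smul, norm_inv, Real.norm_of_nonneg hR.le]; ring
  have hone : ∀ x : Euc d, ‖x‖ ≤ R → b (R⁻¹ • x) = 1 := fun x hx =>
    b.one_of_mem_closedBall (by
      rw [mem_closedBall_zero_iff, hnorm]; exact (div_le_one hR).2 hx)
  have hzero : ∀ x : Euc d, 2 * R ≤ ‖x‖ → b (R⁻¹ • x) = 0 := fun x hx =>
    b.zero_of_le_dist (by
      rw [dist_zero_right, hnorm]; exact (le_div_iff₀ hR).2 hx)
  refine ⟨fun x => b (R⁻¹ • x), hb.comp (contDiff_const_smul _), ?_, fun x => b.nonneg,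
    fun x => b.le_one, hone, hzero, ?_, ?_⟩
  · refine HasCompactSupport.intro (isCompact_closedBall 0 (2 * R)) fun x hx => hzero x ?_
    rw [mem_closedBall_zero_iff, not_le] at hx
    exact hx.le
  · intro i x
    have h : HasFDerivAt (fun x : Euc d => b (R⁻¹ • x))
        ((fderiv ℝ b (R⁻¹ • x)).comp (R⁻¹ • ContinuousLinearMap.id ℝ (Euc d))) x :=
      (hb.differentiable (by simp) _).hasFDerivAt.comp x ((hasFDerivAt_id x).const_smul R⁻¹)
    rw [partialDeriv, h.fderiv]
    simp only [ContinuousLinearMap.comp_smul, ContinuousLinearMap.comp_id,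
      smul_apply, smul_eq_mul, abs_mul, abs_inv, abs_of_pos hR]
    rw [div_eq_inv_mul]
    gcongr
    refine ((fderiv ℝ b (R⁻¹ • x)).le_opNorm _).trans ?_
    simpa using hC (R⁻¹ • x)
  · intro i x hx
    have hx' : ‖x‖ < R ∨ 2 * R < ‖x‖ := by
      by_contra! h
      exact hx ⟨by simpa using h.2, by simpa using h.1⟩
    have hloc : ∃ a : ℝ, (fun y : Euc d => b (R⁻¹ • y)) =ᶠ[𝓝 x] fun _ => a := by
      rcases hx' with h | h
      · refine ⟨1, ?_⟩
        filter_upwards [(isOpen_lt continuous_norm continuous_const).mem_nhds h] with y hy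
        exact hone y (le_of_lt hy)
      · refine ⟨0, ?_⟩
        filter_upwards [(isOpen_lt continuous_const continuous_norm).mem_nhds h] with y hy
        exact hzero y (le_of_lt hy)
    obtain ⟨a, ha⟩ := hloc
    rw [partialDeriv, ha.fderiv_eq]
    simp

/-- Averages `R⁻¹ ∫_{R ≤ |x| ≤ 2R} g` of an `L^{d/(d-1)}` function tend to zero. -/
lemma tendsto_annulus_average (hd : 2 ≤ d) {g : Euc d → ℝ} (hgc : Continuous g)
    (hg0 : ∀ x, 0 ≤ g x)
    (hg : MemLp g (ENNReal.ofReal ((d : ℝ) / ((d : ℝ) - 1))) volume) :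
    Tendsto (fun R : ℝ => R⁻¹ * ∫ x in annulus d R, g x) atTop (𝓝 0) := by
  have hd2 : (2 : ℝ) ≤ d := by exact_mod_cast hd
  set p : ℝ := (d : ℝ) / ((d : ℝ) - 1) with hp
  have hp0 : 0 < p := div_pos (by linarith) (by linarith)
  have hpq : (d : ℝ).HolderConjugate p := by
    rw [Real.holderConjugate_iff]
    refine ⟨by linarith, ?_⟩
    rw [hp]
    have : (d : ℝ) ≠ 0 := by linarith
    field_simp
    ring
  have hint : Integrable (fun x => g x ^ p) := by
    have := hg.integrable_norm_rpow (by simpa using hp0) ENNReal.ofReal_ne_top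
    rw [ENNReal.toReal_ofReal hp0.le] at this
    simpa only [Real.norm_of_nonneg (hg0 _)] using this
  set V : ℝ := volume.real (ball (0 : Euc d) 1) with hV
  have htail : Tendsto (fun R : ℝ => ∫ x in (ball (0 : Euc d) R)ᶜ, g x ^ p) atTop (𝓝 0) := by
    have := tendsto_setIntegral_of_antitone (μ := volume) (f := fun x : Euc d => g x ^ p)
      (s := fun R : ℝ => (ball (0 : Euc d) R)ᶜ) (fun R => measurableSet_ball.compl)
      (fun R R' h => Set.compl_subset_compl.2 (ball_subset_ball h)) ⟨0, hint.integrableOn⟩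
    have he : ⋂ R : ℝ, (ball (0 : Euc d) R)ᶜ = ∅ := by
      ext x
      simp only [Set.mem_iInter, Set.mem_compl_iff, mem_ball_zero_iff, not_lt,
        Set.mem_empty_iff_false, iff_false, not_forall, not_le]
      exact ⟨‖x‖ + 1, by linarith⟩
    rw [he] at this
    simpa using this
  have hyoung : ∀ δ : ℝ, 0 < δ → ∀ R : ℝ, 0 < R → R⁻¹ * ∫ x in annulus d R, g x
      ≤ δ ^ d * 2 ^ d * V + (δ⁻¹) ^ p * ∫ x in (ball (0 : Euc d) R)ᶜ, g x ^ p := by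
    intro δ hδ R hR
    -- Young with the conjugate exponents `d` and `p`. Integrating `R⁻ᵈ` over the annulus gives a
    -- bound uniform in `R`, and the weight `δ` makes that bound small.
    have hpt : ∀ x, R⁻¹ * g x ≤ (δ / R) ^ d + (δ⁻¹) ^ p * g x ^ p := by
      intro x
      have h := Real.young_inequality_of_nonneg (a := δ / R) (b := δ⁻¹ * g x)
        (by positivity) (mul_nonneg (by positivity) (hg0 x)) hpq
      rw [Real.mul_rpow (by positivity) (hg0 x), Real.rpow_natCast] at h
      have e : δ / R * (δ⁻¹ * g x) = R⁻¹ * g x := by field_simp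
      rw [e] at h
      refine h.trans (add_le_add (div_le_self (by positivity) (by linarith))
        (div_le_self (mul_nonneg (by positivity) (Real.rpow_nonneg (hg0 x) _)) hpq.symm.lt.le))
    have hfin : volume (annulus d R) ≠ ⊤ := (isCompact_annulus R).measure_lt_top.ne
    calc R⁻¹ * ∫ x in annulus d R, g x = ∫ x in annulus d R, R⁻¹ * g x :=
          (integral_const_mul _ _).symm
      _ ≤ ∫ x in annulus d R, ((δ / R) ^ d + (δ⁻¹) ^ p * g x ^ p) := by
          refine integral_mono ?_ ?_ hpt
          · exact ((continuous_const.mul hgc).continuousOn.integrableOn_compact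
              (isCompact_annulus R))
          · exact (integrableOn_const hfin).add (hint.const_mul _).integrableOn
      _ = volume.real (annulus d R) * (δ / R) ^ d
            + (δ⁻¹) ^ p * ∫ x in annulus d R, g x ^ p := by
          have hi : IntegrableOn (fun _ : Euc d => (δ / R) ^ d) (annulus d R) :=
            integrableOn_const hfin
          rw [integral_add hi (hint.const_mul _).integrableOn,
            setIntegral_const, integral_const_mul, smul_eq_mul]
      _ ≤ δ ^ d * 2 ^ d * V + (δ⁻¹) ^ p * ∫ x in (ball (0 : Euc d) R)ᶜ, g x ^ p := by
          refine add_le_add ?_ (mul_le_mul_of_nonneg_left ?_ (by positivity))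
          · have hvol : volume.real (annulus d R) ≤ (2 * R) ^ d * V := by
              refine (measureReal_mono Set.sdiff_subset
                (isCompact_closedBall _ _).measure_lt_top.ne).trans_eq ?_
              rw [Measure.addHaar_real_closedBall _ _ (by positivity)]
              simp [hV]
            calc volume.real (annulus d R) * (δ / R) ^ d
                ≤ (2 * R) ^ d * V * (δ / R) ^ d := by gcongr
              _ = δ ^ d * 2 ^ d * V := by
                rw [mul_pow, div_pow]; field_simp
          · exact setIntegral_mono_set hint.integrableOn
              (ae_of_all _ fun x => Real.rpow_nonneg (hg0 x) _)
              (LE.le.eventuallyLE fun x hx => hx.2)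
  have hnn : ∀ R : ℝ, 0 < R → 0 ≤ R⁻¹ * ∫ x in annulus d R, g x := fun R hR =>
    mul_nonneg (by positivity) (integral_nonneg hg0)
  rw [Metric.tendsto_nhds]
  intro ε hε
  have hV0 : 0 ≤ V := measureReal_nonneg
  -- Fix `δ` first to control the volume term; only then let `R` grow to make the tail small.
  obtain ⟨δ, hδ, hδε⟩ : ∃ δ : ℝ, 0 < δ ∧ δ ^ d * 2 ^ d * V < ε / 2 := by
    have hc : Tendsto (fun δ : ℝ => δ ^ d * 2 ^ d * V) (𝓝[>] 0) (𝓝 ((0 : ℝ) ^ d * 2 ^ d * V)) :=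
      (Continuous.tendsto (by fun_prop) 0).mono_left nhdsWithin_le_nhds
    rw [zero_pow (by omega), zero_mul, zero_mul] at hc
    obtain ⟨δ, h1, h2⟩ := ((hc.eventually (gt_mem_nhds (half_pos hε))).and
      self_mem_nhdsWithin).exists
    exact ⟨δ, h2, h1⟩
  have ht : Tendsto (fun R : ℝ => (δ⁻¹) ^ p * ∫ x in (ball (0 : Euc d) R)ᶜ, g x ^ p)
      atTop (𝓝 0) := by
    simpa using htail.const_mul ((δ⁻¹) ^ p)
  filter_upwards [ht.eventually (gt_mem_nhds (half_pos hε)), eventually_gt_atTop 0] with R h1 h2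
  rw [Real.dist_eq, sub_zero, abs_of_nonneg (hnn R h2)]
  linarith [hyoung δ hδ R h2]

/-- A Caccioppoli-type Liouville principle: if `c S ≤ - ∇ · K` with `|K| ≲ g + N √S`, `N² ≤ g`
and the annular averages of `g` vanish at infinity, then `S = 0`. -/
lemma eq_zero_of_le_neg_divergence {S g N : Euc d → ℝ} {K : Fin d → Euc d → ℝ} {c C₀ : ℝ}
    (hc : 0 < c) (hC₀ : 0 ≤ C₀) (hK : ∀ i, ContDiff ℝ 1 (K i)) (hSc : Continuous S)
    (hS0 : ∀ x, 0 ≤ S x) (hgc : Continuous g)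
    (hNg : ∀ x, N x ^ 2 ≤ g x)
    (hKb : ∀ i x, |K i x| ≤ C₀ * (g x + N x * √(S x)))
    (hdiv : ∀ x, c * S x ≤ -∑ i, partialDeriv i (K i) x)
    (hdecay : Tendsto (fun R : ℝ => R⁻¹ * ∫ x in annulus d R, g x) atTop (𝓝 0)) :
    ∀ x, S x = 0 := by
  obtain ⟨L, hL, hcut⟩ := exists_cutoff d
  have hg0 : ∀ x, 0 ≤ g x := fun x => (sq_nonneg _).trans (hNg x)
  -- The factors of `a` are `2` from differentiating `η²`, `d` from summing over coordinates, `C₀`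
  -- from the flux and `L` from the cutoff. The second summand of `C` is the remainder of completing
  -- a square below.
  set a : ℝ := 2 * d * C₀ * L with ha
  have ha0 : 0 ≤ a := by positivity
  set C : ℝ := a + a ^ 2 / (2 * c) with hC
  have hC0 : 0 ≤ C := by positivity
  have main : ∀ R : ℝ, 1 ≤ R → ∃ η : Euc d → ℝ, Continuous η ∧ HasCompactSupport η ∧
      (∀ x, 0 ≤ η x) ∧ (∀ x, η x ≤ 1) ∧
      (∀ x, ‖x‖ ≤ R → η x = 1) ∧ (∀ x, 2 * R ≤ ‖x‖ → η x = 0) ∧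
      c / 2 * ∫ x, η x ^ 2 * S x ≤ C * (R⁻¹ * ∫ x in annulus d R, g x) := by
    intro R hR
    have hR0 : 0 < R := by linarith
    obtain ⟨η, hη, hηc, hη0, hη1, hone, hzero, hηd, hηa⟩ := hcut R hR0
    refine ⟨η, hη.continuous, hηc, hη0, hη1, hone, hzero, ?_⟩
    have hη1' : ContDiff ℝ 1 η := hη.of_le (by simp)
    have hφ : ContDiff ℝ 1 (fun x => η x ^ 2) := hη1'.pow 2
    have hφc : HasCompactSupport (fun x => η x ^ 2) := hasCompactSupport_sq hηc
    have hφd : ∀ i x, partialDeriv i (fun x => η x ^ 2) x = 2 * η x * partialDeriv i η x := by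
      intro i x
      simp only [pow_two]
      rw [partialDeriv_mul i (hη.differentiable (by simp) x) (hη.differentiable (by simp) x)]
      ring
    have iS : Integrable (fun x => η x ^ 2 * S x) :=
      (hφ.continuous.mul hSc).integrable_of_hasCompactSupport hφc.mul_right
    have iK : ∀ i, Integrable (fun x => η x ^ 2 * partialDeriv i (K i) x) := fun i =>
      (hφ.continuous.mul (continuous_partialDeriv i (hK i))).integrable_of_hasCompactSupport
        hφc.mul_right
    have iB : ∀ i, Integrable (fun x => partialDeriv i (fun x => η x ^ 2) x * K i x) := fun i =>
      ((continuous_partialDeriv i hφ).mul (hK i).continuous).integrable_of_hasCompactSupport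
        (hasCompactSupport_partialDeriv i hφc).mul_right
    have ig : Integrable ((annulus d R).indicator g) :=
      (integrable_indicator_iff (measurableSet_annulus R)).2
        (hgc.continuousOn.integrableOn_compact (isCompact_annulus R))
    have hpt : ∀ x, ∑ i, partialDeriv i (fun x => η x ^ 2) x * K i x
        ≤ c / 2 * (η x ^ 2 * S x) + C * R⁻¹ * (annulus d R).indicator g x := by
      intro x
      by_cases hx : x ∈ annulus d R
      · rw [Set.indicator_of_mem hx]
        have h1 : ∀ i, partialDeriv i (fun x => η x ^ 2) x * K i x
            ≤ 2 * η x * (L / R) * (C₀ * (g x + N x * √(S x))) := by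
          intro i
          refine (le_abs_self _).trans ?_
          rw [abs_mul, hφd, abs_mul, abs_mul, abs_two, abs_of_nonneg (hη0 x)]
          have := hη0 x
          gcongr
          · exact hηd i x
          · exact hKb i x
        have h2 := sum_le_sum fun i (_ : i ∈ (univ : Finset (Fin d))) => h1 i
        rw [sum_const, card_univ, Fintype.card_fin, nsmul_eq_mul] at h2
        refine h2.trans ?_
        set q := √(S x) with hq
        have hqS : S x = q ^ 2 := (Real.sq_sqrt (hS0 x)).symm
        have hq0 : 0 ≤ q := Real.sqrt_nonneg _
        set r := R⁻¹ with hr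
        have hr0 : 0 ≤ r := by positivity
        have hr1 : r ≤ 1 := inv_le_one_of_one_le₀ hR
        have e : (d : ℝ) * (2 * η x * (L / R) * (C₀ * (g x + N x * q)))
            = a * r * (η x * g x) + a * r * N x * (η x * q) := by
          rw [ha, hr]; ring
        have h3 : a * r * (η x * g x) ≤ a * r * g x := by
          have : η x * g x ≤ g x := mul_le_of_le_one_left (hg0 x) (hη1 x)
          gcongr
        -- Completing the square: half of the dissipation `c η² S` is spent here, the other half
        -- survives on the left.
        have h4 : a * r * N x * (η x * q)
            ≤ c / 2 * (η x * q) ^ 2 + (a * r * N x) ^ 2 / (2 * c) := by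
          have : c / 2 * (η x * q) ^ 2 + (a * r * N x) ^ 2 / (2 * c) - a * r * N x * (η x * q)
              = (c * (η x * q) - a * r * N x) ^ 2 / (2 * c) := by
            field_simp; ring
          have h5 : 0 ≤ (c * (η x * q) - a * r * N x) ^ 2 / (2 * c) := by positivity
          linarith
        -- The restriction `1 ≤ R` is used here, to weaken `R⁻²` to `R⁻¹`.
        have h6 : (a * r * N x) ^ 2 / (2 * c) ≤ a ^ 2 / (2 * c) * (r * g x) := by
          have : r ^ 2 * N x ^ 2 ≤ r * g x := by
            have : r ^ 2 ≤ r := by nlinarith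
            have := hNg x
            gcongr
          calc (a * r * N x) ^ 2 / (2 * c) = a ^ 2 / (2 * c) * (r ^ 2 * N x ^ 2) := by ring
            _ ≤ _ := by gcongr
        rw [e, hqS, hC]
        nlinarith [h3, h4, h6]
      · rw [Set.indicator_of_notMem hx]
        have : ∀ i, partialDeriv i (fun x => η x ^ 2) x * K i x = 0 := fun i => by
          rw [hφd, hηa i x hx]; ring
        simp only [this, sum_const_zero, mul_zero, add_zero]
        have := hS0 x
        positivity
    have hkey : c * ∫ x, η x ^ 2 * S x
        ≤ ∫ x, ∑ i, partialDeriv i (fun x => η x ^ 2) x * K i x := by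
      rw [integral_finsetSum _ fun i _ => iB i, ← integral_const_mul]
      have : ∀ i, ∫ x, partialDeriv i (fun x => η x ^ 2) x * K i x
          = -∫ x, η x ^ 2 * partialDeriv i (K i) x := fun i => by
        rw [integral_mul_partialDeriv i hφ hφc (hK i), neg_neg]
      simp only [this]
      rw [sum_neg_distrib, ← integral_finsetSum _ fun i _ => iK i, ← integral_neg]
      refine integral_mono (iS.const_mul c) (integrable_finsetSum _ fun i _ => iK i).neg
        fun x => ?_
      simp only [← mul_sum]
      nlinarith [mul_le_mul_of_nonneg_left (hdiv x) (sq_nonneg (η x))]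
    have hup : ∫ x, ∑ i, partialDeriv i (fun x => η x ^ 2) x * K i x
        ≤ c / 2 * (∫ x, η x ^ 2 * S x) + C * R⁻¹ * ∫ x in annulus d R, g x := by
      rw [← integral_indicator (measurableSet_annulus R), ← integral_const_mul,
        ← integral_const_mul, ← integral_add (iS.const_mul _) (ig.const_mul _)]
      exact integral_mono (integrable_finsetSum _ fun i _ => iB i)
        ((iS.const_mul _).add (ig.const_mul _)) hpt
    linarith
  intro x
  by_contra hx
  -- A fixed cutoff equal to `1` at `x`: if `S x ≠ 0`, its weighted energy is a positive number that
  -- the bounds for large `R` force to be nonpositive.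
  set R₀ : ℝ := max 1 ‖x‖ with hR₀
  obtain ⟨η₀, hη₀, hη₀c, hη₀0, hη₀1, hone₀, hzero₀, -⟩ := main R₀ (le_max_left _ _)
  have hcs : HasCompactSupport (fun y => η₀ y ^ 2 * S y) := by
    have : HasCompactSupport (fun y => η₀ y ^ 2) := hasCompactSupport_sq hη₀c
    exact this.mul_right
  have hcont : Continuous (fun y => η₀ y ^ 2 * S y) := (hη₀.pow 2).mul hSc
  have hpos : 0 < ∫ y, η₀ y ^ 2 * S y := by
    refine hcont.integral_pos_of_hasCompactSupport_nonneg_nonzero (x := x) hcs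
      (fun y => mul_nonneg (sq_nonneg _) (hS0 y)) ?_
    rw [hone₀ x (le_max_right _ _)]
    simpa using hx
  have hlim := hdecay.const_mul C
  rw [mul_zero] at hlim
  have hev : ∀ᶠ R : ℝ in atTop, c / 2 * ∫ y, η₀ y ^ 2 * S y
      ≤ C * (R⁻¹ * ∫ x in annulus d R, g x) := by
    -- From `2 * R₀` on, `η = 1` wherever `η₀` can be nonzero, so `η₀² ≤ η²`.
    filter_upwards [eventually_ge_atTop (2 * R₀)] with R hR
    have h1 : 1 ≤ R₀ := le_max_left _ _
    obtain ⟨η, hη, hηc, hη0, hη1, hone, hzero, hE⟩ := main R (by linarith)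
    refine le_trans ?_ hE
    have hcs' : HasCompactSupport (fun y => η y ^ 2 * S y) := by
      have : HasCompactSupport (fun y => η y ^ 2) := hasCompactSupport_sq hηc
      exact this.mul_right
    refine mul_le_mul_of_nonneg_left (integral_mono
      (hcont.integrable_of_hasCompactSupport hcs)
      (((hη.pow 2).mul hSc).integrable_of_hasCompactSupport hcs') fun y => ?_) (by positivity)
    refine mul_le_mul_of_nonneg_right ?_ (hS0 y)
    rcases le_total ‖y‖ R with h | h
    · rw [hone y h]
      exact pow_le_pow_left₀ (hη₀0 y) (hη₀1 y) 2
    · rw [hzero₀ y (hR.trans h)]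
      simpa using sq_nonneg (η y)
  have := ge_of_tendsto hlim hev
  have : 0 < c / 2 * ∫ y, η₀ y ^ 2 * S y := by positivity
  linarith

end Integration

open Finset

/-! ### Energy inequality and vanishing of the velocity gradient. -/

section Solutions

variable {d : ℕ} {μ lam A γ : ℝ} {ρ : Euc d → ℝ} {v : Euc d → Euc d}

namespace IsSmoothStationarySolution

lemma contDiff_component (h : IsSmoothStationarySolution μ lam A γ ρ v) (i : Fin d) :
    ContDiff ℝ ∞ fun y => v y i :=
  (EuclideanSpace.proj i : Euc d →L[ℝ] ℝ).contDiff.comp h.smooth_velocity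

lemma sum_partialDeriv_mass (h : IsSmoothStationarySolution μ lam A γ ρ v) (x : Euc d) :
    ∑ i, partialDeriv i (fun y => ρ y * v y i) x = 0 := h.mass x

lemma momentum_component (h : IsSmoothStationarySolution μ lam A γ ρ v) (hγ : 1 < γ) (x : Euc d)
    (i : Fin d) :
    ∑ j, partialDeriv j (fun y => ρ y * v y i * v y j) x =
      -(A * partialDeriv i (fun y => ρ y ^ γ) x)
        + μ * ∑ j, partialDeriv j (partialDeriv j fun y => v y i) x
        + (μ + lam) * partialDeriv i (fun y => ∑ j, partialDeriv j (fun z => v z j) y) x := by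
  have hm := h.momentum x i
  rw [gradient_apply, gradient_apply, laplacian_apply h.smooth_velocity] at hm
  have hP : partialDeriv i (pressure A γ ρ) x = A * partialDeriv i (fun y => ρ y ^ γ) x :=
    partialDeriv_const_mul i A
      ((h.smooth_density.differentiable (by simp) x).rpow_const (Or.inr hγ.le))
  rw [hP] at hm
  exact hm

/-- Local energy identity, tested with the velocity and corrected by the null form
`∇ · ((v · ∇) v - (∇ · v) v)` so that the dissipation is coercive. -/
lemma energy_le (h : IsSmoothStationarySolution μ lam A γ ρ v) (hγ : 1 < γ) {c : ℝ}
    (hcμ : c ≤ μ) (hcl : c ≤ lam + 2 * μ) (x : Euc d) :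
    c * ∑ i, ∑ j, partialDeriv i (fun y => v y j) x ^ 2 ≤
      -∑ i, partialDeriv i (fun y =>
        1 / 2 * ((ρ y * v y i) * ∑ j, v y j * v y j) + A * γ / (γ - 1) * (ρ y ^ γ * v y i)
        - μ * (∑ j, v y j * partialDeriv i (fun z => v z j) y)
        - (lam + 2 * μ - c) * (v y i * ∑ j, partialDeriv j (fun z => v z j) y)
        + (μ - c) * (∑ j, v y j * partialDeriv j (fun z => v z i) y)) x := by
  have hu := h.contDiff_component
  have hρ := h.smooth_density
  have dρ : DifferentiableAt ℝ ρ x := hρ.differentiable (by simp) x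
  have du : ∀ i, DifferentiableAt ℝ (fun y => v y i) x :=
    fun i => (hu i).differentiable (by simp) x
  have ddu : ∀ i j, DifferentiableAt ℝ (partialDeriv i (fun y => v y j)) x :=
    fun i j => (contDiff_partialDeriv i (hu j)).differentiable (by simp) x
  have dD : DifferentiableAt ℝ (fun y => ∑ j, partialDeriv j (fun z => v z j) y) x :=
    DifferentiableAt.fun_sum fun j _ => ddu j j
  have hsplit : ∀ i, partialDeriv i (fun y =>
        1 / 2 * ((ρ y * v y i) * ∑ j, v y j * v y j) + A * γ / (γ - 1) * (ρ y ^ γ * v y i)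
        - μ * (∑ j, v y j * partialDeriv i (fun z => v z j) y)
        - (lam + 2 * μ - c) * (v y i * ∑ j, partialDeriv j (fun z => v z j) y)
        + (μ - c) * (∑ j, v y j * partialDeriv j (fun z => v z i) y)) x
      = 1 / 2 * partialDeriv i (fun y => (ρ y * v y i) * ∑ j, v y j * v y j) x
        + A * γ / (γ - 1) * partialDeriv i (fun y => ρ y ^ γ * v y i) x
        - μ * partialDeriv i (fun y => ∑ j, v y j * partialDeriv i (fun z => v z j) y) x
        - (lam + 2 * μ - c)
          * partialDeriv i (fun y => v y i * ∑ j, partialDeriv j (fun z => v z j) y) x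
        + (μ - c) * partialDeriv i (fun y => ∑ j, v y j * partialDeriv j (fun z => v z i) y) x := by
    intro i
    have d1 : DifferentiableAt ℝ (fun y => (ρ y * v y i) * ∑ j, v y j * v y j) x :=
      (dρ.fun_mul (du i)).fun_mul (DifferentiableAt.fun_sum fun j _ => (du j).fun_mul (du j))
    have d2 : DifferentiableAt ℝ (fun y => ρ y ^ γ * v y i) x :=
      (dρ.rpow_const (Or.inr hγ.le)).fun_mul (du i)
    have d3 : DifferentiableAt ℝ
        (fun y => ∑ j, v y j * partialDeriv i (fun z => v z j) y) x :=
      DifferentiableAt.fun_sum fun j _ => (du j).fun_mul (ddu i j)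
    have d4 : DifferentiableAt ℝ
        (fun y => v y i * ∑ j, partialDeriv j (fun z => v z j) y) x := (du i).fun_mul dD
    have d5 : DifferentiableAt ℝ
        (fun y => ∑ j, v y j * partialDeriv j (fun z => v z i) y) x :=
      DifferentiableAt.fun_sum fun j _ => (du j).fun_mul (ddu j i)
    rw [partialDeriv_add i ((((d1.const_mul _).fun_add (d2.const_mul _)).fun_sub
        (d3.const_mul _)).fun_sub (d4.const_mul _)) (d5.const_mul _),
      partialDeriv_sub i (((d1.const_mul _).fun_add (d2.const_mul _)).fun_sub
        (d3.const_mul _)) (d4.const_mul _),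
      partialDeriv_sub i ((d1.const_mul _).fun_add (d2.const_mul _)) (d3.const_mul _),
      partialDeriv_add i (d1.const_mul _) (d2.const_mul _),
      partialDeriv_const_mul i _ d1, partialDeriv_const_mul i _ d2, partialDeriv_const_mul i _ d3,
      partialDeriv_const_mul i _ d4, partialDeriv_const_mul i _ d5]
  simp only [hsplit, sum_add_distrib, sum_sub_distrib, ← mul_sum]
  have e1 := sum_partialDeriv_kineticFlux hρ hu x (h.sum_partialDeriv_mass x)
  have e2 := sum_partialDeriv_rpow_mul hγ hρ hu x (h.density_nonneg x) (h.sum_partialDeriv_mass x)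
  have e3 := sum_partialDeriv_gradFlux hu x
  have e4 := sum_partialDeriv_divFlux hu x
  have e5 := sum_partialDeriv_advectFlux hu x
  have hnull := sum_mul_swap_le_sum_sq fun i j => partialDeriv i (fun y => v y j) x
  have hm : ∑ i, v x i * ∑ j, partialDeriv j (fun y => ρ y * v y i * v y j) x
      = -(A * ∑ i, v x i * partialDeriv i (fun y => ρ y ^ γ) x)
        + μ * ∑ i, v x i * ∑ j, partialDeriv j (partialDeriv j fun y => v y i) x
        + (μ + lam) * ∑ i, v x i
          * partialDeriv i (fun y => ∑ j, partialDeriv j (fun z => v z j) y) x := by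
    simp only [h.momentum_component hγ x, mul_add, sum_add_distrib]
    congr 2
    · rw [mul_sum, ← sum_neg_distrib]
      exact sum_congr rfl fun i _ => by ring
    · rw [mul_sum]
      exact sum_congr rfl fun i _ => by ring
    · rw [mul_sum (a := μ + lam)]
      exact sum_congr rfl fun i _ => by ring
  have e2' : A * γ / (γ - 1) * ∑ i, partialDeriv i (fun y => ρ y ^ γ * v y i) x
      = A * ∑ i, v x i * partialDeriv i (fun y => ρ y ^ γ) x := by
    have : γ - 1 ≠ 0 := by linarith
    field_simp
    linear_combination A * e2
  rw [e1, e2', e3, e4, e5, hm]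
  -- The slack in the inequality is exactly `(μ - c) (|∇v|² - ∑ ∂ᵢvⱼ ∂ⱼvᵢ) + (lam + 2 μ - c) (∇ ·
  -- v)²`.
  have h1 := mul_le_mul_of_nonneg_left hnull (sub_nonneg.2 hcμ)
  have h2 := mul_nonneg (sub_nonneg.2 hcl) (sq_nonneg (∑ j, partialDeriv j (fun y => v y j) x))
  nlinarith [h1, h2]

/-- A solution with bounded density whose velocity has vanishing annular averages of
`|v| + |v|³` has vanishing velocity gradient. -/
lemma partialDeriv_velocity_eq_zero (h : IsSmoothStationarySolution μ lam A γ ρ v)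
    (hμ : 0 < μ) (hlam : 0 < lam + 2 * μ) (hγ : 1 < γ) {M : ℝ}
    (hM : ∀ x, ρ x ≤ M)
    (hdecay : Filter.Tendsto (fun R : ℝ => R⁻¹ * ∫ x in annulus d R, (‖v x‖ + ‖v x‖ ^ 3))
      Filter.atTop (nhds 0)) (i j : Fin d) (x : Euc d) :
    partialDeriv i (fun y => v y j) x = 0 := by
  have hu := h.contDiff_component
  have hρ := h.smooth_density
  -- The largest `c` for which both `μ - c` and `lam + 2 * μ - c` are nonnegative.
  set c : ℝ := min μ (lam + 2 * μ) with hc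
  have hc0 : 0 < c := lt_min hμ hlam
  have hM0 : 0 ≤ M := (h.density_nonneg x).trans (hM x)
  set S : Euc d → ℝ := fun x => ∑ i, ∑ j, partialDeriv i (fun y => v y j) x ^ 2 with hS
  have hS0 : ∀ x, 0 ≤ S x := fun x => sum_nonneg fun i _ => sum_nonneg fun j _ => sq_nonneg _
  have hSc : Continuous S := continuous_finsetSum _ fun i _ => continuous_finsetSum _ fun j _ =>
    (contDiff_partialDeriv i (hu j)).continuous.pow 2
  have hle : ∀ i j x, |partialDeriv i (fun y => v y j) x| ≤ √(S x) := by
    intro i j x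
    refine Real.abs_le_sqrt ?_
    exact (single_le_sum (f := fun j => partialDeriv i (fun y => v y j) x ^ 2)
      (fun j _ => sq_nonneg _) (mem_univ j)).trans
      (single_le_sum (f := fun i => ∑ j, partialDeriv i (fun y => v y j) x ^ 2)
        (fun i _ => sum_nonneg fun j _ => sq_nonneg _) (mem_univ i))
  have hvle : ∀ i x, |v x i| ≤ ‖v x‖ := fun i x => PiLp.norm_apply_le (v x) i
  set B : ℝ := |A * γ / (γ - 1)| with hB
  -- One summand per term of the flux; each `d` counts the components in an inner sum.
  set C₀ : ℝ := 1 / 2 * (M * d) + B * M ^ γ + |μ| * d + |lam + 2 * μ - c| * d + |μ - c| * d with hC₀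
  have hC₀0 : 0 ≤ C₀ := by positivity
  have hzero : ∀ x, S x = 0 := by
    refine eq_zero_of_le_neg_divergence (g := fun x => ‖v x‖ + ‖v x‖ ^ 3) (N := fun x => ‖v x‖)
      (K := fun i y =>
        1 / 2 * ((ρ y * v y i) * ∑ j, v y j * v y j) + A * γ / (γ - 1) * (ρ y ^ γ * v y i)
        - μ * (∑ j, v y j * partialDeriv i (fun z => v z j) y)
        - (lam + 2 * μ - c) * (v y i * ∑ j, partialDeriv j (fun z => v z j) y)
        + (μ - c) * (∑ j, v y j * partialDeriv j (fun z => v z i) y))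
      hc0 hC₀0 ?_ hSc hS0 ?_ ?_ ?_
      (h.energy_le hγ (min_le_left _ _) (min_le_right _ _)) hdecay
    · intro i
      have hu1 : ∀ i, ContDiff ℝ 1 (fun y => v y i) := fun i => (hu i).of_le (by simp)
      have hρ1 : ContDiff ℝ 1 ρ := hρ.of_le (by simp)
      have hP : ContDiff ℝ 1 (fun y => ρ y ^ γ) :=
        hρ1.rpow_const_of_le (m := 1) (by exact_mod_cast hγ.le)
      have hdu : ∀ i j, ContDiff ℝ 1 (partialDeriv i (fun y => v y j)) :=
        fun i j => (contDiff_partialDeriv i (hu j)).of_le (by simp)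
      have c1 : ContDiff ℝ 1 (fun y => ∑ j, v y j * v y j) :=
        ContDiff.sum fun j _ => (hu1 j).mul (hu1 j)
      have c3 : ContDiff ℝ 1 (fun y => ∑ j, v y j * partialDeriv i (fun z => v z j) y) :=
        ContDiff.sum fun j _ => (hu1 j).mul (hdu i j)
      have c4 : ContDiff ℝ 1 (fun y => ∑ j, partialDeriv j (fun z => v z j) y) :=
        ContDiff.sum fun j _ => hdu j j
      have c5 : ContDiff ℝ 1 (fun y => ∑ j, v y j * partialDeriv j (fun z => v z i) y) :=
        ContDiff.sum fun j _ => (hu1 j).mul (hdu j i)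
      exact ((((contDiff_const.mul ((hρ1.mul (hu1 i)).mul c1)).add
        (contDiff_const.mul (hP.mul (hu1 i)))).sub (contDiff_const.mul c3)).sub
        (contDiff_const.mul ((hu1 i).mul c4))).add (contDiff_const.mul c5)
    · have := h.smooth_velocity.continuous
      fun_prop
    · intro x
      -- From `n (n - 1)² ≥ 0` one gets `2 n² ≤ n + n³`.
      nlinarith [norm_nonneg (v x), mul_nonneg (norm_nonneg (v x)) (sq_nonneg (‖v x‖ - 1))]
    · intro i x
      dsimp only
      set n := ‖v x‖ with hn
      set q := √(S x) with hq
      have hn0 : 0 ≤ n := norm_nonneg _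
      have hq0 : 0 ≤ q := Real.sqrt_nonneg _
      have hsum : ∀ (f : Fin d → ℝ) (b : ℝ), (∀ j, |f j| ≤ b) → |∑ j, f j| ≤ d * b := by
        intro f b hf
        refine (abs_sum_le_sum_abs _ _).trans ((sum_le_sum fun j _ => hf j).trans_eq ?_)
        simp
      have b1 : |1 / 2 * ((ρ x * v x i) * ∑ j, v x j * v x j)|
          ≤ 1 / 2 * ((M * n) * (d * (n * n))) := by
        rw [abs_mul, abs_mul, abs_mul, abs_of_nonneg (h.density_nonneg x),
          abs_of_pos (by norm_num : (0 : ℝ) < 1 / 2)]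
        have hs := hsum (fun j => v x j * v x j) (n * n) fun j => by
          rw [abs_mul]
          exact mul_le_mul (hvle j x) (hvle j x) (abs_nonneg _) hn0
        have := hM x
        have := hvle i x
        gcongr
      have b2 : |A * γ / (γ - 1) * (ρ x ^ γ * v x i)| ≤ B * (M ^ γ * n) := by
        rw [abs_mul, abs_mul, abs_of_nonneg (Real.rpow_nonneg (h.density_nonneg x) _)]
        have := Real.rpow_le_rpow (h.density_nonneg x) (hM x) (by linarith : (0 : ℝ) ≤ γ)
        have := hvle i x
        gcongr
      have hprod : ∀ k l m, |v x k * partialDeriv l (fun z => v z m) x| ≤ n * q := by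
        intro k l m
        rw [abs_mul]
        exact mul_le_mul (hvle k x) (hle l m x) (abs_nonneg _) hn0
      have b3 : |μ * (∑ j, v x j * partialDeriv i (fun z => v z j) x)| ≤ |μ| * (d * (n * q)) := by
        rw [abs_mul]
        exact mul_le_mul_of_nonneg_left (hsum _ _ fun j => hprod j i j) (abs_nonneg _)
      have b4 : |(lam + 2 * μ - c) * (v x i * ∑ j, partialDeriv j (fun z => v z j) x)|
          ≤ |lam + 2 * μ - c| * (d * (n * q)) := by
        rw [abs_mul, mul_sum]
        exact mul_le_mul_of_nonneg_left (hsum _ _ fun j => hprod i j j) (abs_nonneg _)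
      have b5 : |(μ - c) * (∑ j, v x j * partialDeriv j (fun z => v z i) x)|
          ≤ |μ - c| * (d * (n * q)) := by
        rw [abs_mul]
        exact mul_le_mul_of_nonneg_left (hsum _ _ fun j => hprod j j i) (abs_nonneg _)
      have htri : ∀ a₁ a₂ a₃ a₄ a₅ : ℝ,
          |a₁ + a₂ - a₃ - a₄ + a₅| ≤ |a₁| + |a₂| + |a₃| + |a₄| + |a₅| := fun a₁ a₂ a₃ a₄ a₅ => by
        refine (abs_add_le _ _).trans (add_le_add_left ?_ _)
        refine (abs_sub _ _).trans (add_le_add_left ?_ _)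
        refine (abs_sub _ _).trans (add_le_add_left ?_ _)
        exact abs_add_le _ _
      refine (htri _ _ _ _ _).trans ((add_le_add (add_le_add (add_le_add (add_le_add b1 b2) b3) b4)
        b5).trans ?_)
      -- Each flux term needs only one of `n³`, `n`, `n q`; these are the surplus products when
      -- every coefficient multiplies `n + n³ + n q`.
      have p1 : 0 ≤ 1 / 2 * (M * d) * (n + n * q) := by positivity
      have p2 : 0 ≤ B * M ^ γ * (n ^ 3 + n * q) := by positivity
      have p3 : 0 ≤ (|μ| * d + |lam + 2 * μ - c| * d + |μ - c| * d) * (n + n ^ 3) := by positivity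
      rw [hC₀]
      linarith
  have := hle i j x
  rw [hzero x, Real.sqrt_zero] at this
  exact abs_nonpos_iff.1 this

end IsSmoothStationarySolution

lemma eq_of_partialDeriv_eq_zero {f : Euc d → ℝ} (hf : Differentiable ℝ f)
    (h : ∀ i x, partialDeriv i f x = 0) (x y : Euc d) : f x = f y := by
  refine is_const_of_fderiv_eq_zero (𝕜 := ℝ) hf (fun z => ?_) x y
  apply ContinuousLinearMap.coe_injective
  refine (EuclideanSpace.basisFun (Fin d) ℝ).toBasis.ext fun i => ?_
  simpa [partialDeriv] using h i z

/-- The essential bound holds on a set that is dense, being of full measure, and closed, by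
continuity; hence everywhere. -/
lemma le_of_memLp_top (hc : Continuous ρ) (hρ : MemLp ρ ⊤ volume) : ∃ M, ∀ x, ρ x ≤ M := by
  refine ⟨lpNorm ρ ⊤ volume, fun x => ?_⟩
  have hdense := Measure.dense_of_ae (ae_le_lpNorm_exponent_top hρ)
  have hclosed : IsClosed {x | ‖ρ x‖ ≤ lpNorm ρ ⊤ volume} := isClosed_le hc.norm continuous_const
  exact (le_abs_self _).trans
    (hclosed.closure_subset (hdense x) : ‖ρ x‖ ≤ lpNorm ρ ⊤ volume)

end Solutions

end CompressibleNS

/-! ### The Liouville theorem. -/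

theorem theorem2 (d : ℕ) (hd : 2 ≤ d) (μ lam A γ : ℝ)
    (hμ : 0 < μ) (hlam : 0 < lam + 2 * μ) (hA : 0 < A) (hγ : 1 < γ)
    (ρ : EuclideanSpace ℝ (Fin d) → ℝ)
    (v : EuclideanSpace ℝ (Fin d) → EuclideanSpace ℝ (Fin d))
    (hsol : CompressibleNS.IsSmoothStationarySolution μ lam A γ ρ v)
    (hρ : MemLp ρ ⊤ volume)
    (hv₁ : MemLp v (ENNReal.ofReal ((d : ℝ) / ((d : ℝ) - 1))) volume)
    (hv₂ : MemLp v (ENNReal.ofReal (3 * (d : ℝ) / ((d : ℝ) - 1))) volume) :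
    (∀ x, v x = 0) ∧ ∃ c : ℝ, ∀ x, ρ x = c := by
  have hd2 : (2 : ℝ) ≤ d := by exact_mod_cast hd
  have hp0 : 0 < (d : ℝ) / ((d : ℝ) - 1) := div_pos (by linarith) (by linarith)
  have hvc : Continuous v := hsol.smooth_velocity.continuous
  obtain ⟨M, hM⟩ := CompressibleNS.le_of_memLp_top hsol.smooth_density.continuous hρ
  have hcube : MemLp (fun x => ‖v x‖ ^ 3) (ENNReal.ofReal ((d : ℝ) / ((d : ℝ) - 1))) volume := by
    have h := hv₂.norm_rpow_div 3
    have e : ENNReal.ofReal (3 * (d : ℝ) / ((d : ℝ) - 1)) / 3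
        = ENNReal.ofReal ((d : ℝ) / ((d : ℝ) - 1)) := by
      rw [show (3 : ENNReal) = ENNReal.ofReal 3 by simp, ← ENNReal.ofReal_div_of_pos (by norm_num)]
      congr 1
      ring
    rw [e] at h
    refine h.congr_norm (by fun_prop) (Filter.Eventually.of_forall fun x => ?_)
    simp
  have hdecay := CompressibleNS.tendsto_annulus_average hd (g := fun x => ‖v x‖ + ‖v x‖ ^ 3)
    (by fun_prop) (fun x => by positivity) (hv₁.norm.add hcube)
  have hgrad := hsol.partialDeriv_velocity_eq_zero hμ hlam hγ hM hdecay
  have hconst : ∀ x, v x = v 0 := fun x => by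
    ext j
    exact CompressibleNS.eq_of_partialDeriv_eq_zero
      ((hsol.contDiff_component j).differentiable (by simp)) (fun i y => hgrad i j y) x 0
  have hv0 : v 0 = 0 := by
    have hL : MemLp (fun _ : EuclideanSpace ℝ (Fin d) => v 0)
        (ENNReal.ofReal ((d : ℝ) / ((d : ℝ) - 1))) volume := by
      have : v = fun _ => v 0 := funext hconst
      rwa [this] at hv₁
    -- Nontriviality makes the total volume infinite, which excludes nonzero constants from
    -- `L^{d/(d-1)}`.
    have : Nontrivial (EuclideanSpace ℝ (Fin d)) :=
      Module.nontrivial_of_finrank_pos (R := ℝ) (by simp; omega)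
    rcases (memLp_const_iff (by simpa using hp0) ENNReal.ofReal_ne_top).1 hL with h | h
    · exact h
    · simp at h
  have hv : ∀ x, v x = 0 := fun x => (hconst x).trans hv0
  refine ⟨hv, ρ 0, fun x => ?_⟩
  have hv' : v = fun _ => 0 := funext hv
  -- With `v = 0` only the pressure gradient is left in the momentum equation.
  have hgradP : ∀ i y, CompressibleNS.partialDeriv i (fun z => ρ z ^ γ) y = 0 := by
    intro i y
    have hm := hsol.momentum_component hγ y i
    rw [hv'] at hm
    have : A * CompressibleNS.partialDeriv i (fun z => ρ z ^ γ) y = 0 := by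
      simpa [CompressibleNS.partialDeriv_const, -mul_eq_zero] using hm.symm
    exact (mul_eq_zero.1 this).resolve_left hA.ne'
  have hP := CompressibleNS.eq_of_partialDeriv_eq_zero
    ((hsol.smooth_density.differentiable (by simp)).rpow_const fun _ => Or.inr hγ.le) hgradP x 0
  exact (Real.rpow_left_inj (hsol.density_nonneg x) (hsol.density_nonneg 0) (by linarith)).1 hP
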